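/- Let $X$ be a two-dimensional real normed space, identified with $\mathbb{R}^2$ by a linear isomorphism, whose unit sphere $S_X$ is a regular polygon with $2n$ vertices, where $n\in\mathbb{N}$, $n\ge 3$; regular means that all edges of $S_X$ have the same length and all interior angles have the same measure, with respect to the Euclidean metric of $\mathbb{R}^2$. Write $x\perp_B y$ if $\|x+\lambda y\|\ge\|x\|$ for all $\lambda\in\mathbb{R}$, and, for $\varepsilon\in[0,1)$, write $x\perp_B^{\varepsilon}y$ if $\|x+\lambda y\|^2\ge\|x\|^2-2\varepsilon\|x\|\,\|\lambda y\|$ for all $\lambda\in\mathbb{R}$. Then Birkhoff-James orthogonality is C-approximately symmetric in $X$: there exists $\varepsilon\in[0,1)$ such that for all $x,y\in X$, $x\perp_B y$ implies $y\perp_B^{\varepsilon}x$. -/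

import Mathlib

/-- `x ⊥_B y`: Birkhoff-James orthogonality in a real normed space. -/
def BirkhoffJamesOrthogonal {X : Type*} [NormedAddCommGroup X] [NormedSpace ℝ X] (x y : X) : Prop :=
  ∀ t : ℝ, ‖x‖ ≤ ‖x + t • y‖

/-- `x ⊥_B^ε y`: approximate Birkhoff-James orthogonality in the sense of Chmieliński. -/
def ApproxBirkhoffJamesOrthogonal {X : Type*} [NormedAddCommGroup X] [NormedSpace ℝ X]
    (ε : ℝ) (x y : X) : Prop :=
  ∀ t : ℝ, ‖x‖ ^ 2 - 2 * ε * ‖x‖ * ‖t • y‖ ≤ ‖x + t • y‖ ^ 2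

/-- Birkhoff-James orthogonality is C-approximately symmetric in `X`: one `ε ∈ [0, 1)` works
for all pairs `x, y`. -/
def CApproximatelySymmetric (X : Type*) [NormedAddCommGroup X] [NormedSpace ℝ X] : Prop :=
  ∃ ε : ℝ, 0 ≤ ε ∧ ε < 1 ∧
    ∀ x y : X, BirkhoffJamesOrthogonal x y → ApproxBirkhoffJamesOrthogonal ε y x

/-- The unit sphere of `X` is the polygon `P` (vertices listed in cyclic order): the listed
vertices are distinct, they are exactly the extreme points of the closed unit ball, and the
edges joining consecutive vertices make up the unit sphere. -/
structure IsUnitSpherePolygon {X : Type*} [NormedAddCommGroup X] [NormedSpace ℝ X] {m : ℕ}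
    (P : Polygon X m) : Prop where
  injective_vertices : Function.Injective P.vertices
  range_vertices : Set.range P.vertices = Set.extremePoints ℝ (Metric.closedBall (0 : X) 1)
  boundary_eq : P.boundary ℝ = Metric.sphere (0 : X) 1

/-- A polygon in the Euclidean plane all of whose edges have the same length and all of whose
(convex) interior angles have the same measure. -/
structure IsEquilateralEquiangular {m : ℕ} (Q : Polygon (EuclideanSpace ℝ (Fin 2)) m) : Prop where
  edges_eq : ∀ i j : Fin m,
    dist (Q i) (Q (finRotate m i)) = dist (Q j) (Q (finRotate m j))
  angles_eq : ∀ i j : Fin m,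
    EuclideanGeometry.angle (Q i) (Q (finRotate m i)) (Q (finRotate m (finRotate m i))) =
      EuclideanGeometry.angle (Q j) (Q (finRotate m j)) (Q (finRotate m (finRotate m j)))

/-- `X` is a two-dimensional regular polyhedral space with `m` vertices: `X` is the plane (via a
linear isomorphism `e`) with a norm whose unit sphere is a polygon with `m` vertices that is
regular with respect to the Euclidean metric of the plane. -/
def IsRegularPolyhedralPlane (X : Type*) [NormedAddCommGroup X] [NormedSpace ℝ X] (m : ℕ) : Prop :=
  ∃ (e : X ≃ₗ[ℝ] EuclideanSpace ℝ (Fin 2)) (P : Polygon X m),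
    IsUnitSpherePolygon P ∧ IsEquilateralEquiangular (Polygon.mk fun i => e (P i))

/-! Let `v i` be the vertices in cyclic order and `g i` a norm-one functional equal to `1` on the
edge from `v i` to `v (i + 1)`. Equal edges and equal angles, together with convexity (all vertices
lie on one side of each edge), make the edge vectors satisfy a recurrence
`e (i + 1) + e (i - 1) = t • e i` (`add_eq_smul_of_opposite_sides`). Since the vertices sum to `0`
by central symmetry, the vertices satisfy the same recurrence
(`RegularPolygonalNorm.exists_recurrence`).
Evaluating `g i` at the next two vertices shows `t = 0` or `1 ≤ t`; having at least five distinct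
vertices excludes `t = 0`, and extremality of the vertices gives `t < 2`.

With `ε = max (1 / 2) (t - 1)`, suppose `x ⊥_B y` are unit vectors, `y` on the edge `[a, b]`
between consecutive vertices. It suffices to find a norm-one functional attaining its norm at `y`
and at most `ε` in absolute value at `x`. If the functional `g` of the edge fails, then (up to
sign) `x` is near that edge: either on it or on an adjacent one. There the norm is given by an
explicit linear function, and moving from `x` in the direction `-y` decreases it, contradicting
`x ⊥_B y`. The exception is `t = 1` (the hexagon) with `y` the endpoint of the edge farther
from `x`; then the functional of the other edge at `y` works
(`RegularPolygonalNorm.adjacent_edge_bound`). -/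

open scoped RealInnerProductSpace

section Orthogonality

variable {X : Type*} [NormedAddCommGroup X] [NormedSpace ℝ X]

theorem BirkhoffJamesOrthogonal.smul_smul {x y : X} (h : BirkhoffJamesOrthogonal x y) (a b : ℝ) :
    BirkhoffJamesOrthogonal (a • x) (b • y) := by
  intro s
  rcases eq_or_ne a 0 with rfl | ha
  · simp
  have key := h (a⁻¹ * (s * b))
  have : a • x + s • b • y = a • (x + (a⁻¹ * (s * b)) • y) := by
    rw [smul_add, _root_.smul_smul, _root_.smul_smul, mul_inv_cancel_left₀ ha]
  rw [this, norm_smul, norm_smul]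
  gcongr

/-- A support functional at `y` that is small at `x` witnesses `y ⊥_B^ε x`. -/
theorem ApproxBirkhoffJamesOrthogonal.of_functional {ε : ℝ} {x y : X} (f : X →ₗ[ℝ] ℝ)
    (hf : ∀ z, |f z| ≤ ‖z‖) (hy : f y = ‖y‖) (hx : |f x| ≤ ε * ‖x‖) :
    ApproxBirkhoffJamesOrthogonal ε y x := by
  intro s
  have h1 : ‖y‖ + s * f x ≤ ‖y + s • x‖ := by
    have := (le_abs_self _).trans (hf (y + s • x))
    simpa [hy] using this
  have h2 : -(ε * ‖s • x‖) ≤ s * f x := by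
    have h3 : |s * f x| ≤ ε * ‖s • x‖ := by
      rw [abs_mul, norm_smul, Real.norm_eq_abs]
      nlinarith [mul_le_mul_of_nonneg_left hx (abs_nonneg s)]
    exact (abs_le.mp h3).1
  have h4 : ‖y‖ - ε * ‖s • x‖ ≤ ‖y + s • x‖ := by linarith
  rcases le_total 0 (‖y‖ - ε * ‖s • x‖) with h | h
  · nlinarith [mul_self_le_mul_self h h4, sq_nonneg (ε * ‖s • x‖)]
  · nlinarith [mul_nonneg (norm_nonneg y) (sub_nonneg.2 (sub_nonpos.1 h)),
      sq_nonneg (‖y + s • x‖), sq_nonneg ‖y‖]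

/-- It suffices to find the support functional for unit vectors. -/
theorem CApproximatelySymmetric.of_unit {ε : ℝ} (h0 : 0 ≤ ε) (h1 : ε < 1)
    (h : ∀ x y : X, ‖x‖ = 1 → ‖y‖ = 1 → BirkhoffJamesOrthogonal x y →
      ∃ f : X →ₗ[ℝ] ℝ, (∀ z, |f z| ≤ ‖z‖) ∧ f y = 1 ∧ |f x| ≤ ε) :
    CApproximatelySymmetric X := by
  refine ⟨ε, h0, h1, fun x y hxy => ?_⟩
  rcases eq_or_ne x 0 with rfl | hx
  · intro s; simp
  rcases eq_or_ne y 0 with rfl | hy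
  · intro s; simp
  have hx' := norm_pos_iff.2 hx
  have hy' := norm_pos_iff.2 hy
  obtain ⟨f, hf, hfy, hfx⟩ := h (‖x‖⁻¹ • x) (‖y‖⁻¹ • y)
    (norm_smul_inv_norm hx) (norm_smul_inv_norm hy) (hxy.smul_smul _ _)
  refine .of_functional f hf ?_ ?_
  · rw [map_smul, smul_eq_mul] at hfy
    field_simp at hfy
    exact hfy
  · rw [map_smul, smul_eq_mul, abs_mul, abs_of_pos (inv_pos.2 hx')] at hfx
    field_simp at hfx
    linarith

end Orthogonality

/-! ### The recurrence for edge vectors -/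

/-- In the plane, two vectors of equal length that have the same inner product with `e` and lie on
opposite sides of the line through `e` are mirror images in that line. -/
theorem add_eq_smul_of_opposite_sides {e u w : EuclideanSpace ℝ (Fin 2)} (he : e ≠ 0)
    (hn : ‖u‖ = ‖w‖) (hi : ⟪u, e⟫ = ⟪w, e⟫)
    (G : EuclideanSpace ℝ (Fin 2) →ₗ[ℝ] ℝ) (hG : G ≠ 0) (hGe : G e = 0)
    (hu : G u ≤ 0) (hw : 0 ≤ G w) :
    u + w = (2 * ⟪u, e⟫ / ‖e‖ ^ 2) • e := by
  -- `J` is `e` turned by a right angle, and `D x` is the determinant of `e` and `x`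
  set J : EuclideanSpace ℝ (Fin 2) := !₂[-e 1, e 0] with hJ
  set D : EuclideanSpace ℝ (Fin 2) → ℝ := fun x => e 0 * x 1 - e 1 * x 0 with hD
  have hin : ∀ x y : EuclideanSpace ℝ (Fin 2), ⟪x, y⟫ = x 0 * y 0 + x 1 * y 1 := by
    intro x y; simp [PiLp.inner_apply, Fin.sum_univ_two, mul_comm]
  have hns : ∀ x : EuclideanSpace ℝ (Fin 2), ‖x‖ ^ 2 = x 0 ^ 2 + x 1 ^ 2 := by
    intro x; rw [← real_inner_self_eq_norm_sq, hin]; ring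
  have hL : 0 < ‖e‖ ^ 2 := by positivity
  have dec : ∀ x : EuclideanSpace ℝ (Fin 2), ‖e‖ ^ 2 • x = ⟪x, e⟫ • e + D x • J := by
    intro x
    ext i
    fin_cases i <;> simp [hns, hin, hJ, hD] <;> ring
  have hGx : ∀ x, ‖e‖ ^ 2 * G x = D x * G J := by
    intro x
    have := congrArg G (dec x)
    simpa [hGe] using this
  have hGJ : G J ≠ 0 := by
    intro h0
    refine hG (LinearMap.ext fun x => ?_)
    have := hGx x
    rw [h0, mul_zero] at this
    simpa [hL.ne'] using this
  have hsq : ∀ x, D x ^ 2 = ‖e‖ ^ 2 * ‖x‖ ^ 2 - ⟪x, e⟫ ^ 2 := by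
    intro x; rw [hns, hns, hin]; simp only [hD]; ring
  have hD2 : D u ^ 2 = D w ^ 2 := by rw [hsq, hsq, hn, hi]
  have hsum : D u + D w = 0 := by
    rcases sq_eq_sq_iff_eq_or_eq_neg.1 hD2 with h | h
    · have h1 := hGx u
      have h2 := hGx w
      rw [← h] at h2
      have h3 : D u * G J = 0 := by
        apply le_antisymm
        · rw [← h1]; exact mul_nonpos_of_nonneg_of_nonpos hL.le hu
        · rw [← h2]; exact mul_nonneg hL.le hw
      have h4 : D u = 0 := (mul_eq_zero.1 h3).resolve_right hGJ
      rw [← h, h4, add_zero]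
    · rw [h]; ring
  have hfin : ‖e‖ ^ 2 • (u + w) = (2 * ⟪u, e⟫) • e := by
    rw [smul_add, dec u, dec w, ← hi]
    have : D w = -D u := by linarith
    rw [this]; module
  rw [div_eq_inv_mul, mul_smul, ← hfin, inv_smul_smul₀ hL.ne']

namespace RegularPolygonalNorm

variable {X : Type*} [NormedAddCommGroup X] [NormedSpace ℝ X]

/-! ### Support functionals near an edge -/

/-- Let `x = p • a + q • b` be a unit vector with `q ≤ 0`, so that it lies beyond `a` as seen from
the edge `[a, b]`; here `p + q` is the value at `x` of the functional of that edge. If this value is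
large, then `x` lies on the adjacent edge `[t • a - b, a]`; being orthogonal to `y ∈ [a, b]` forces `t = 1` and `y = b`. -/
theorem adjacent_edge_bound {a b x y : X} {t p q l : ℝ} (ht1 : 1 ≤ t) (ht2 : t < 2)
    (ha : ‖a‖ ≤ 1) (ha' : ‖t • a - b‖ ≤ 1) (h k : X →ₗ[ℝ] ℝ) (hh : ∀ z, |h z| ≤ ‖z‖)
    (ha1 : h a = 1) (hb1 : h b = t - 1) (kb : k b = 1) (ka : k a = t - 1)
    (hq : q ≤ 0) (hx : x = p • a + q • b) (hx1 : ‖x‖ = 1)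
    (hl0 : 0 ≤ l) (hl1 : l ≤ 1) (hy : y = (1 - l) • a + l • b)
    (hxy : BirkhoffJamesOrthogonal x y) (hpq : max (1 / 2) (t - 1) < p + q) :
    k y = 1 ∧ |k x| ≤ max (1 / 2) (t - 1) := by
  obtain ⟨hpq1, hpq2⟩ := max_lt_iff.1 hpq
  have hhx : p + q * (t - 1) ≤ 1 := by
    have := (le_abs_self _).trans (hh x)
    rw [hx1, hx] at this
    simpa [ha1, hb1] using this
  have hp : t * (-q) < p := by
    by_contra! hc
    have h1 : (2 - t) * (p + q) ≤ (2 - t) * ((t - 1) * (-q)) :=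
      mul_le_mul_of_nonneg_left (by linarith) (by linarith)
    have h2 : (t - 1) * (p + q) ≤ (t - 1) * (1 - (2 - t) * (-q)) :=
      mul_le_mul_of_nonneg_left (by linarith) (by linarith)
    linarith
  -- an upper bound for the norm on the cone spanned by `t • a - b` and `a`
  have cone : ∀ α β : ℝ, 0 ≤ β → β * t ≤ α → ‖α • a - β • b‖ ≤ α - (t - 1) * β := by
    intro α β hβ hαβ
    have e1 : α • a - β • b = β • (t • a - b) + (α - β * t) • a := by module
    have h1 : ‖β • (t • a - b)‖ ≤ β * 1 := by
      rw [norm_smul, Real.norm_of_nonneg hβ]; gcongr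
    have h2 : ‖(α - β * t) • a‖ ≤ (α - β * t) * 1 := by
      rw [norm_smul, Real.norm_of_nonneg (sub_nonneg.2 hαβ)]
      exact mul_le_mul_of_nonneg_left ha (sub_nonneg.2 hαβ)
    rw [e1]
    linarith [norm_add_le (β • (t • a - b)) ((α - β * t) • a)]
  have hxn : 1 ≤ p - (t - 1) * (-q) := by
    have := cone p (-q) (by linarith) (by linarith)
    have e1 : p • a - (-q) • b = x := by rw [hx]; module
    rwa [e1, hx1] at this
  have hδ : (1 - l) + (t - 1) * l ≤ 0 := by
    by_contra! hc
    -- a step `s` small enough for `x - s • y` to stay in the cone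
    have hs : 0 < (p - t * (-q)) / (1 + t) := div_pos (by linarith) (by linarith)
    set s := (p - t * (-q)) / (1 + t) with hs'
    have hs2 : s * (1 + t) = p - t * (-q) := div_mul_cancel₀ _ (by linarith)
    have e1 : x + (-s) • y = (p - s * (1 - l)) • a - (-q + s * l) • b := by
      rw [hx, hy]; module
    have h1 := hxy (-s)
    rw [e1, hx1] at h1
    have h2 := cone (p - s * (1 - l)) (-q + s * l)
      (add_nonneg (by linarith) (mul_nonneg hs.le hl0)) (by
        have : s * ((1 - l) + l * t) ≤ s * (1 + t) :=
          mul_le_mul_of_nonneg_left (by nlinarith) hs.le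
        linarith)
    have h3 : 0 < s * ((1 - l) + (t - 1) * l) := mul_pos hs hc
    linarith
  have hl : l = 1 := by
    have := mul_nonneg (sub_nonneg.2 ht1) hl0
    linarith
  subst hl
  have ht : t = 1 := by linarith
  subst ht
  refine ⟨by simp [hy, kb], le_trans ?_ (le_max_left _ _)⟩
  have : k x = q := by simp [hx, ka, kb]
  rw [this, abs_le]
  constructor <;> linarith

/-- Given the functionals `g`, `h`, `k` of an edge `[a, b]` and of its two neighbours, one of them
supports `y ∈ [a, b]` and is at most `max (1 / 2) (t - 1)` at `x`. -/
theorem exists_support_functional_of_edge {a b x y : X} {t p q l : ℝ} (ht1 : 1 ≤ t) (ht2 : t < 2)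
    (ha : ‖a‖ ≤ 1) (hb : ‖b‖ ≤ 1) (ha' : ‖t • a - b‖ ≤ 1) (hb' : ‖t • b - a‖ ≤ 1)
    (g h k : X →ₗ[ℝ] ℝ) (hg : ∀ z, |g z| ≤ ‖z‖)
    (hh : ∀ z, |h z| ≤ ‖z‖) (hk : ∀ z, |k z| ≤ ‖z‖) (ga : g a = 1) (gb : g b = 1)
    (ha1 : h a = 1) (hb1 : h b = t - 1) (kb : k b = 1) (ka : k a = t - 1)
    (hx : x = p • a + q • b) (hx1 : ‖x‖ = 1)
    (hl0 : 0 ≤ l) (hl1 : l ≤ 1) (hy : y = (1 - l) • a + l • b)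
    (hxy : BirkhoffJamesOrthogonal x y) :
    ∃ f : X →ₗ[ℝ] ℝ, (∀ z, |f z| ≤ ‖z‖) ∧ f y = 1 ∧ |f x| ≤ max (1 / 2) (t - 1) := by
  have gy : g y = 1 := by simp [hy, ga, gb]
  have gx : g x = p + q := by simp [hx, ga, gb]
  rcases le_or_gt |g x| (max (1 / 2) (t - 1)) with hle | hlt
  · exact ⟨g, hg, gy, hle⟩
  wlog hpos : 0 ≤ g x generalizing x p q
  · have hxy' : BirkhoffJamesOrthogonal (-x) y := by
      simpa using hxy.smul_smul (-1) 1
    obtain ⟨f, hf, hfy, hfx⟩ := this (x := -x) (p := -p) (q := -q) (by rw [hx]; module)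
      (by rwa [norm_neg]) hxy' (by rw [map_neg, gx]; ring) (by rwa [map_neg, abs_neg])
      (by rw [map_neg]; linarith)
    exact ⟨f, hf, hfy, by rwa [map_neg, abs_neg] at hfx⟩
  rw [abs_of_nonneg hpos, gx] at hlt
  rcases le_or_gt q 0 with hq | hq
  · exact ⟨k, hk, adjacent_edge_bound ht1 ht2 ha ha' h k hh ha1 hb1 kb ka hq hx hx1 hl0 hl1 hy
      hxy hlt⟩
  rcases le_or_gt p 0 with hp | hp
  · exact ⟨h, hh, adjacent_edge_bound (l := 1 - l) ht1 ht2 hb hb' k h hk kb ka ha1 hb1 hp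
      (by rw [hx, add_comm]) hx1 (by linarith) (by linarith) (by rw [hy]; module) hxy
      (by rwa [add_comm])⟩
  -- `x` is inside the edge, so `x - s • y = (1 - s) • z` with `z` on the edge for small `s > 0`
  exfalso
  have cone : ∀ α β : ℝ, 0 ≤ α → 0 ≤ β → ‖α • a + β • b‖ ≤ α + β := by
    intro α β hα hβ
    refine (norm_add_le _ _).trans ?_
    rw [norm_smul, norm_smul, Real.norm_of_nonneg hα, Real.norm_of_nonneg hβ]
    nlinarith
  have hpq : p + q ≤ 1 := by
    rw [← gx, ← hx1]; exact (le_abs_self _).trans (hg x)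
  have hs : 0 < min p q := lt_min hp hq
  have h1 := hxy (-min p q)
  have e1 : x + (-min p q) • y = (p - min p q * (1 - l)) • a + (q - min p q * l) • b := by
    rw [hx, hy]; module
  have h2 := cone (p - min p q * (1 - l)) (q - min p q * l)
    (by nlinarith [min_le_left p q]) (by nlinarith [min_le_right p q])
  rw [e1, hx1] at h1
  linarith

/-- A segment in the unit sphere lies in the level set of a functional of norm at most one. -/
theorem exists_functional_of_segment_subset_sphere {a b : X}
    (h : segment ℝ a b ⊆ Metric.sphere (0 : X) 1) :
    ∃ g : X →ₗ[ℝ] ℝ, (∀ z, |g z| ≤ ‖z‖) ∧ g a = 1 ∧ g b = 1 := by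
  have hm : ‖midpoint ℝ a b‖ = 1 := by simpa using h (midpoint_mem_segment a b)
  have ha : ‖a‖ = 1 := by simpa using h (left_mem_segment ℝ a b)
  have hb : ‖b‖ = 1 := by simpa using h (right_mem_segment ℝ a b)
  obtain ⟨g, hg, hgm⟩ := exists_dual_vector'' ℝ (midpoint ℝ a b)
  have hgz : ∀ z, |g z| ≤ ‖z‖ := fun z => by
    simpa using g.le_of_opNorm_le hg z
  rw [hm, midpoint_eq_smul_add, map_smul, map_add] at hgm
  have h1 := (le_abs_self _).trans (hgz a)
  have h2 := (le_abs_self _).trans (hgz b)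
  rw [ha] at h1
  rw [hb] at h2
  simp at hgm
  exact ⟨g.toLinearMap, hgz, by simp; linarith, by simp; linarith⟩

/-! ### The recurrence for vertices -/

variable {m : ℕ} {P : Polygon X m}

/-- The vertices are permuted by `x ↦ -x`, hence sum to zero. -/
theorem sum_vertices_eq_zero (hP : IsUnitSpherePolygon P) : ∑ i, P i = 0 := by
  have hneg : ∀ i, ∃ j, P j = -P i := by
    intro i
    have hi : P i ∈ Set.extremePoints ℝ (Metric.closedBall (0 : X) 1) := by
      rw [← hP.range_vertices]; exact ⟨i, rfl⟩
    have : -P i ∈ Set.extremePoints ℝ (Metric.closedBall (0 : X) 1) := by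
      rw [mem_extremePoints_iff_left] at hi ⊢
      refine ⟨by simpa using hi.1, fun y hy z hz hyz => ?_⟩
      have := hi.2 (-y) (by simpa using hy) (-z) (by simpa using hz) (by
        obtain ⟨α, β, h1, h2, h3, h4⟩ := hyz
        exact ⟨α, β, h1, h2, h3, by rw [← neg_neg (P i), ← h4]; module⟩)
      rw [← this, neg_neg]
    rw [← hP.range_vertices] at this
    exact this
  choose τ hτ using hneg
  have hinj : Function.Injective τ := by
    intro i j hij
    apply hP.injective_vertices
    rw [← neg_inj, ← hτ i, ← hτ j, hij]
  have hsum := (Finite.injective_iff_bijective.1 hinj).sum_comp P.vertices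
  simp only [hτ, Finset.sum_neg_distrib] at hsum
  have : (2 : ℝ) • ∑ i, P i = 0 := by
    rw [two_smul]; nth_rewrite 1 [← hsum]; exact neg_add_cancel _
  exact (smul_eq_zero.1 this).resolve_left two_ne_zero

variable [NeZero m]

theorem segment_subset_sphere (hP : IsUnitSpherePolygon P) (i : Fin m) :
    segment ℝ (P i) (P (i + 1)) ⊆ Metric.sphere (0 : X) 1 := by
  rw [← hP.boundary_eq, ← affineSegment_eq_segment, ← finRotate_apply]
  exact Set.subset_iUnion (P.edgeSet ℝ) i

theorem norm_vertex (hP : IsUnitSpherePolygon P) (i : Fin m) : ‖P i‖ = 1 := by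
  simpa using segment_subset_sphere hP i (left_mem_segment ℝ _ _)

/-- A function on `Fin m` that is invariant under the cyclic shift is constant, so it vanishes
as soon as its sum does. -/
theorem eq_zero_of_shift_invariant_of_sum {W : Fin m → X} (hW : ∀ i, W (i + 1) = W i)
    (hsum : ∑ i, W i = 0) (i : Fin m) : W i = 0 := by
  have hnat : ∀ k : ℕ, W (Fin.ofNat m k) = W (Fin.ofNat m 0) := by
    intro k
    induction k with
    | zero => rfl
    | succ k ih =>
      rw [← ih, ← hW (Fin.ofNat m k)]
      congr 1
      ext
      simp [Fin.val_add]
  have hconst : ∀ j, W j = W (Fin.ofNat m 0) := by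
    intro j
    rw [← hnat j.val]
    congr 1
    ext
    simp
  rw [Finset.sum_congr rfl fun j _ => hconst j] at hsum
  simp only [Finset.sum_const, Finset.card_univ, Fintype.card_fin] at hsum
  rw [← Nat.cast_smul_eq_nsmul ℝ] at hsum
  rw [hconst i]
  exact (smul_eq_zero.1 hsum).resolve_left (Nat.cast_ne_zero.2 (NeZero.ne m))

/-- Consecutive vertices satisfy `v (i + 2) + v i = t • v (i + 1)` with `t` independent of `i`. -/
theorem exists_recurrence (hm : 2 ≤ m) (e : X ≃ₗ[ℝ] EuclideanSpace ℝ (Fin 2))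
    (hP : IsUnitSpherePolygon P) (hQ : IsEquilateralEquiangular (Polygon.mk fun i => e (P i))) :
    ∃ t : ℝ, ∀ i, P (i + 1 + 1) + P i = t • P (i + 1) := by
  set d : Fin m → X := fun i => P (i + 1) - P i with hd
  have hone : (1 : Fin m) ≠ 0 := by
    rw [Ne, Fin.ext_iff]
    simp [Nat.mod_eq_of_lt (show 1 < m by lia)]
  have hd0 : ∀ i, d i ≠ 0 := fun i h =>
    hone (by simpa using hP.injective_vertices (sub_eq_zero.1 h))
  have hlen : ∀ i, ‖e (d i)‖ = ‖e (d 0)‖ := by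
    intro i
    have := hQ.edges_eq i 0
    simp only [finRotate_apply, dist_eq_norm] at this
    rw [norm_sub_rev, ← map_sub, norm_sub_rev, ← map_sub] at this
    exact this
  have hang : ∀ i, ⟪e (d i), e (d (i + 1))⟫ = ⟪e (d 0), e (d (0 + 1))⟫ := by
    intro i
    have := hQ.angles_eq i 0
    simp only [finRotate_apply, EuclideanGeometry.angle, vsub_eq_sub, ← map_sub] at this
    have hneg : ∀ j, P j - P (j + 1) = -d j := fun j => (neg_sub _ _).symm
    simp only [hneg, map_neg, InnerProductGeometry.angle_neg_left, sub_right_inj] at this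
    change InnerProductGeometry.angle (e (d i)) (e (d (i + 1))) =
      InnerProductGeometry.angle (e (d 0)) (e (d (0 + 1))) at this
    rw [← InnerProductGeometry.cos_angle_mul_norm_mul_norm (e (d i)), this, hlen i,
      hlen (i + 1), ← InnerProductGeometry.cos_angle_mul_norm_mul_norm (e (d 0)), hlen (0 + 1)]
  refine ⟨2 * ⟪e (d 0), e (d (0 + 1))⟫ / ‖e (d 0)‖ ^ 2, ?_⟩
  set t := 2 * ⟪e (d 0), e (d (0 + 1))⟫ / ‖e (d 0)‖ ^ 2 with ht
  have hrec : ∀ i, d (i + 1 + 1) + d i = t • d (i + 1) := by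
    intro i
    obtain ⟨g, hg, g1, g2⟩ :=
      exists_functional_of_segment_subset_sphere (segment_subset_sphere hP (i + 1))
    have hgP : ∀ j, g (P j) ≤ 1 := fun j =>
      (le_abs_self _).trans ((hg _).trans_eq (norm_vertex hP j))
    have key := add_eq_smul_of_opposite_sides (e := e (d (i + 1))) (u := e (d (i + 1 + 1)))
      (w := e (d i)) (by simpa using hd0 (i + 1)) (by rw [hlen, hlen i])
      (by rw [real_inner_comm, hang (i + 1), hang i])
      (g ∘ₗ e.symm.toLinearMap)
      (by
        intro h0
        have := LinearMap.congr_fun h0 (e (P (i + 1)))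
        simp [g1] at this)
      (by simp [hd, g1, g2])
      (by simpa [hd, g2] using hgP _)
      (by simpa [hd, g1] using hgP _)
    rw [real_inner_comm, hang, hlen] at key
    apply e.injective
    rw [map_add, map_smul]
    exact key
  -- the defect of the vertex recurrence is constant and sums to zero
  have hW := eq_zero_of_shift_invariant_of_sum
    (W := fun i => P (i + 1 + 1) + P i - t • P (i + 1))
    (by
      intro i
      have := hrec i
      simp only [hd] at this
      rw [← sub_eq_zero] at this ⊢
      rw [← this]
      module)
    (by
      have hs : ∀ f : Fin m → X, ∑ i, f (i + 1) = ∑ i, f i := fun f =>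
        Equiv.sum_comp (Equiv.addRight (1 : Fin m)) f
      rw [Finset.sum_sub_distrib, Finset.sum_add_distrib, ← Finset.smul_sum,
        hs (fun i => P (i + 1)), hs P.vertices, sum_vertices_eq_zero hP]
      simp)
  exact fun i => sub_eq_zero.1 (hW i)

/-- The functional of the edge `[v 0, v 1]` takes at the next two vertices the values `t - 1` and
`t * (t - 1) - 1`; these lie in `[-1, 1]` only if `t = 0` or `1 ≤ t`. -/
theorem one_le_of_recurrence (hm : 5 ≤ m) (hP : IsUnitSpherePolygon P) {t : ℝ}
    (ht : ∀ i, P (i + 1 + 1) + P i = t • P (i + 1)) : 1 ≤ t := by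
  obtain ⟨g, hg, g1, g2⟩ :=
    exists_functional_of_segment_subset_sphere (segment_subset_sphere hP 0)
  have hgP : ∀ j, |g (P j)| ≤ 1 := fun j => (hg _).trans_eq (norm_vertex hP j)
  have e2 := congrArg g (ht 0)
  have e3 := congrArg g (ht (0 + 1))
  rw [map_add, map_smul, g1, g2, smul_eq_mul] at e2
  rw [map_add, map_smul, g2, smul_eq_mul] at e3
  have b2 := abs_le.1 (hgP (0 + 1 + 1))
  have b3 := abs_le.1 (hgP (0 + 1 + 1 + 1))
  have e2' : g (P (0 + 1 + 1)) = t - 1 := by linarith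
  rw [e2'] at e3 b2
  by_contra! hlt
  have h0 : t = 0 := by
    by_contra h0
    have : 0 < t := lt_of_le_of_ne (by linarith [b2.1]) (Ne.symm h0)
    nlinarith [b3.1]
  -- for `t = 0` the sequence of vertices has period four
  have h4 : P (0 + 1 + 1 + 1 + 1) = P 0 := by
    have h1 := ht (0 + 1 + 1)
    have h2 := ht 0
    rw [h0, zero_smul] at h1 h2
    rw [eq_neg_of_add_eq_zero_left h1, eq_neg_of_add_eq_zero_left h2, neg_neg]
  have h5 := congrArg Fin.val (hP.injective_vertices h4)
  simp [Fin.val_add, Nat.mod_eq_of_lt (show 4 < m by lia)] at h5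

/-- For `t = 2` each vertex would be the midpoint of its neighbours, contradicting extremality. -/
theorem lt_two_of_recurrence (hm : 2 ≤ m) (hP : IsUnitSpherePolygon P) {t : ℝ}
    (ht : ∀ i, P (i + 1 + 1) + P i = t • P (i + 1)) : t < 2 := by
  have hle : t ≤ 2 := by
    have h1 := norm_add_le (P (0 + 1 + 1)) (P 0)
    rw [ht 0, norm_smul, norm_vertex hP, norm_vertex hP, norm_vertex hP, mul_one] at h1
    linarith [le_abs_self t, Real.norm_eq_abs t]
  refine lt_of_le_of_ne hle ?_
  rintro rfl
  have hi : P (0 + 1) ∈ Set.extremePoints ℝ (Metric.closedBall (0 : X) 1) := by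
    rw [← hP.range_vertices]; exact ⟨_, rfl⟩
  have heq := (mem_extremePoints_iff_left.1 hi).2 (P 0) (by simp [norm_vertex hP])
    (P (0 + 1 + 1)) (by simp [norm_vertex hP])
    ⟨1 / 2, 1 / 2, by norm_num, by norm_num, by norm_num, by
      rw [← smul_add, add_comm, ht 0]; module⟩
  have h5 := congrArg Fin.val (hP.injective_vertices heq)
  simp [Nat.mod_eq_of_lt (show 1 < m by lia)] at h5

theorem exists_eq_smul_add_smul (e : X ≃ₗ[ℝ] EuclideanSpace ℝ (Fin 2)) {a b : X} (hab : a ≠ b)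
    {g : X →ₗ[ℝ] ℝ} (ga : g a = 1) (gb : g b = 1) (x : X) : ∃ p q : ℝ, x = p • a + q • b := by
  have hfr : Module.finrank ℝ X = 2 := by rw [e.finrank_eq]; simp
  have hli : LinearIndependent ℝ ![a, b] := by
    rw [LinearIndependent.pair_iff]
    intro s r hsr
    have h1 := congrArg g hsr
    simp [ga, gb] at h1
    have hr : r = -s := by linarith
    rw [hr] at hsr
    have h2 : s • (a - b) = 0 := by rw [← hsr]; module
    have hs : s = 0 := (smul_eq_zero.1 h2).resolve_right (sub_ne_zero.2 hab)
    exact ⟨hs, by rw [hr, hs, neg_zero]⟩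
  have hspan := hli.span_eq_top_of_card_eq_finrank (by simp [hfr])
  have hx : x ∈ Submodule.span ℝ (Set.range ![a, b]) := by rw [hspan]; trivial
  rw [Matrix.range_cons, Matrix.range_cons, Matrix.range_empty, Set.union_empty,
    Set.singleton_union, Submodule.mem_span_pair] at hx
  obtain ⟨p, q, h⟩ := hx
  exact ⟨p, q, h.symm⟩

theorem exists_support_functional (hm : 5 ≤ m) (e : X ≃ₗ[ℝ] EuclideanSpace ℝ (Fin 2))
    (hP : IsUnitSpherePolygon P) {t : ℝ} (ht : ∀ i, P (i + 1 + 1) + P i = t • P (i + 1))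
    {x y : X} (hx : ‖x‖ = 1) (hy : ‖y‖ = 1) (hxy : BirkhoffJamesOrthogonal x y) :
    ∃ f : X →ₗ[ℝ] ℝ, (∀ z, |f z| ≤ ‖z‖) ∧ f y = 1 ∧ |f x| ≤ max (1 / 2) (t - 1) := by
  have hyb : y ∈ P.boundary ℝ := by rw [hP.boundary_eq]; simpa using hy
  obtain ⟨j, l, ⟨hl0, hl1⟩, hly⟩ := Set.mem_iUnion.1 hyb
  obtain ⟨i, rfl⟩ : ∃ i, j = i + 1 := ⟨j - 1, (sub_add_cancel j 1).symm⟩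
  rw [finRotate_apply, AffineMap.lineMap_apply_module] at hly
  obtain ⟨h, hh, h1, h2⟩ :=
    exists_functional_of_segment_subset_sphere (segment_subset_sphere hP i)
  obtain ⟨g, hg, g1, g2⟩ :=
    exists_functional_of_segment_subset_sphere (segment_subset_sphere hP (i + 1))
  obtain ⟨k, hk, k1, k2⟩ :=
    exists_functional_of_segment_subset_sphere (segment_subset_sphere hP (i + 1 + 1))
  have hne : P (i + 1) ≠ P (i + 1 + 1) := by
    intro h0
    have h5 := hP.injective_vertices h0
    have h6 := congrArg Fin.val (left_eq_add.1 h5)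
    simp [Nat.mod_eq_of_lt (show 1 < m by lia)] at h6
  obtain ⟨p, q, hpq⟩ := exists_eq_smul_add_smul e hne g1 g2 x
  have hprev : t • P (i + 1) - P (i + 1 + 1) = P i := by rw [← ht i]; abel
  have hnext : t • P (i + 1 + 1) - P (i + 1) = P (i + 1 + 1 + 1) := by
    rw [← ht (i + 1)]; abel
  have hb1 := congrArg h hprev
  have ka := congrArg k hnext
  rw [map_sub, map_smul, h1, h2, smul_eq_mul] at hb1
  rw [map_sub, map_smul, k1, k2, smul_eq_mul] at ka
  exact exists_support_functional_of_edge (one_le_of_recurrence hm hP ht)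
    (lt_two_of_recurrence (by lia) hP ht) (norm_vertex hP _).le (norm_vertex hP _).le
    (by rw [hprev, norm_vertex hP]) (by rw [hnext, norm_vertex hP]) g h k hg hh hk g1 g2 h2
    (by linarith) k1 (by linarith) hpq hx hl0 hl1 hly.symm hxy

end RegularPolygonalNorm

/-! ### Approximate symmetry -/

open RegularPolygonalNorm in
theorem mainTheorem4 {X : Type*} [NormedAddCommGroup X] [NormedSpace ℝ X]
    (n : ℕ) (hn : 3 ≤ n) (hX : IsRegularPolyhedralPlane X (2 * n)) :
    CApproximatelySymmetric X := by
  obtain ⟨e, P, hP, hQ⟩ := hX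
  have : NeZero (2 * n) := ⟨by lia⟩
  obtain ⟨t, ht⟩ := exists_recurrence (by lia) e hP hQ
  have ht2 := lt_two_of_recurrence (by lia) hP ht
  exact .of_unit (ε := max (1 / 2) (t - 1)) (by positivity)
    (max_lt (by norm_num) (by linarith))
    fun x y hx hy hxy => exists_support_functional (by lia) e hP ht hx hy hxy
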